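/- Let $\mathbb{K}$ be a field and let $R=\bigoplus_{t\ge 0}R_t$ be a standard graded $\mathbb{K}$-algebra, i.e. $R\neq 0$ is a commutative graded ring with $R_0=\mathbb{K}$ which is generated as a $\mathbb{K}$-algebra by $R_1$, and $\dim_{\mathbb{K}}R_1<\infty$. Put $d=\dim R$. For a finitely generated graded $R$-module $M$ let $$\mathrm{e}(M)=\lim_{t\to\infty}\frac{d!\,\sum_{i=0}^{t}\dim_{\mathbb{K}}[M]_i}{t^{d}}$$ be its Hilbert--Samuel multiplicity as an $R$-module (so $\mathrm{e}(M)=0$ if $\dim M<d$). For integers $t,\ell\ge 1$ let $$\mathcal{F}_{t,\ell}=\{F=\{f_1,\ldots,f_\ell\}\subseteq R_t \mid f_1,\ldots,f_\ell \text{ are } \mathbb{K}\text{-linearly independent and } \operatorname{Ann}_R(F)\neq 0\},$$ and let the generalized minimum distance function be $$\delta_R(t,\ell)=\begin{cases}\mathrm{e}(R)-\max\{\mathrm{e}(R/(F))\mid F\in\mathcal{F}_{t,\ell}\} & \text{if }\mathcal{F}_{t,\ell}\neq\varnothing,\\ \mathrm{e}(R) & \text{if }\mathcal{F}_{t,\ell}=\varnothing.\end{cases}$$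 Let $s_R(\ell)=\lim_{t\to\infty}\delta_R(t,\ell)$ be the stabilization value, and let $r_R(\ell)=\min\{t\ge 1\mid \delta_R(t,\ell)=s_R(\ell)\}$ be the regularity index. Theorem. Suppose that $R$ is reduced and that $\operatorname{depth}(R)\ge 2$, where $\operatorname{depth}(R)$ is the supremum of the lengths of regular sequences on $R$ contained in the ideal $\bigoplus_{t>0}R_t$. Then for every $\ell\ge 1$ one has $\delta_R(t,\ell)=s_R(\ell)$ for all $t\gg 0$ (so that $r_R(\ell)$ is well defined), and $$r_R(\ell+1)\le r_R(\ell)+1 .$$ -/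

import Mathlib

open Filter Topology

noncomputable section

namespace GMD

/-- A grading `R = ⨁ₜ 𝒜 t` of a `K`-algebra `R` is standard if `R ≠ 0`, `𝒜 0 = K`, and `R` is
generated as a `K`-algebra by the finite-dimensional space `𝒜 1` of linear forms. -/
structure IsStandardGraded {K R : Type*} [Field K] [CommRing R] [Algebra K R]
    (𝒜 : ℕ → Submodule K R) [GradedAlgebra 𝒜] : Prop where
  nontrivial : Nontrivial R
  zero_eq : 𝒜 0 = 1
  finite_one : FiniteDimensional K (𝒜 1)
  adjoin_one : Algebra.adjoin K (𝒜 1 : Set R) = ⊤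

/-- The depth of a graded ring: the supremum of the lengths of regular sequences on `R` that
consist of elements of the irrelevant ideal `⨁_{t > 0} 𝒜 t`. -/
def depth {K R : Type*} [Field K] [CommRing R] [Algebra K R]
    (𝒜 : ℕ → Submodule K R) [GradedAlgebra 𝒜] : ℕ∞ :=
  ⨆ (rs : List R) (_ : ∀ r ∈ rs, r ∈ (HomogeneousIdeal.irrelevant 𝒜).toIdeal)
    (_ : RingTheory.Sequence.IsRegular R rs), (rs.length : ℕ∞)

/-- The Hilbert function `t ↦ dim_K [M]_t` of a graded vector space with pieces `ℳ t`. -/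
def hilbertFunction {K M : Type*} [Field K] [AddCommGroup M] [Module K M]
    (ℳ : ℕ → Submodule K M) (t : ℕ) : ℕ :=
  Module.finrank K (ℳ t)

/-- The Krull dimension of `R` as a natural number (it is finite for a nonzero finitely generated
algebra over a field). -/
def dim (R : Type*) [CommRing R] : ℕ :=
  ((ringKrullDim R).unbotD 0).toNat

/-- The Hilbert–Samuel multiplicity `e_R(M) = lim_t d! (∑_{i ≤ t} h_M(i)) / t ^ d` of a graded
`R`-module `M` with graded pieces `ℳ t`, where `d = dim R`; in particular it is `0` when
`dim M < dim R`. -/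
def mult (R : Type*) [CommRing R] {K M : Type*} [Field K] [AddCommGroup M] [Module K M]
    (ℳ : ℕ → Submodule K M) : ℝ :=
  limUnder atTop fun t : ℕ =>
    ((dim R).factorial * ∑ i ∈ Finset.range (t + 1), (hilbertFunction ℳ i : ℝ)) /
      (t : ℝ) ^ dim R

/-- The graded pieces `[R/I]_t`, the images of the `𝒜 t`, of a quotient `R/I`. -/
def quotientPieces {K R : Type*} [Field K] [CommRing R] [Algebra K R]
    (𝒜 : ℕ → Submodule K R) (I : Ideal R) (t : ℕ) : Submodule K (R ⧸ I) :=
  (𝒜 t).map (Ideal.Quotient.mkₐ K I).toLinearMap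

/-- The set `ℱ_{t,ℓ}` of `K`-linearly independent `f₁, …, f_ℓ` in `R_t` whose annihilator in `R`
is nonzero. -/
def family {K R : Type*} [Field K] [CommRing R] [Algebra K R]
    (𝒜 : ℕ → Submodule K R) (t ℓ : ℕ) : Set (Fin ℓ → R) :=
  {F | (∀ i, F i ∈ 𝒜 t) ∧ LinearIndependent K F ∧
    (Ideal.span (Set.range F)).annihilator ≠ ⊥}

open Classical in
/-- The generalized minimum distance function `δ_R(t, ℓ)`, for `t, ℓ ≥ 1`. -/
def delta {K R : Type*} [Field K] [CommRing R] [Algebra K R]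
    (𝒜 : ℕ → Submodule K R) (t ℓ : ℕ) : ℝ :=
  if (family 𝒜 t ℓ).Nonempty then
    mult R 𝒜 -
      sSup ((fun F => mult R (quotientPieces 𝒜 (Ideal.span (Set.range F)))) '' family 𝒜 t ℓ)
  else mult R 𝒜

/-- The stabilization value `s_R(ℓ) = lim_t δ_R(t, ℓ)`. -/
def stabilizationValue {K R : Type*} [Field K] [CommRing R] [Algebra K R]
    (𝒜 : ℕ → Submodule K R) (ℓ : ℕ) : ℝ :=
  limUnder atTop fun t : ℕ => delta 𝒜 t ℓ

/-- The regularity index `r_R(ℓ) = min {t ≥ 1 | δ_R(t, ℓ) = s_R(ℓ)}`. -/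
def regularityIndex {K R : Type*} [Field K] [CommRing R] [Algebra K R]
    (𝒜 : ℕ → Submodule K R) (ℓ : ℕ) : ℕ :=
  sInf {t : ℕ | 1 ≤ t ∧ delta 𝒜 t ℓ = stabilizationValue 𝒜 ℓ}

end GMD

end

/-!
The multiplicities `e(R/(F))` are natural numbers that can only grow when the ideal `(F)` shrinks,
so it suffices to move between the families `ℱ_{t,ℓ}` without enlarging ideals.

The key point is that, in depth at least two, an ideal `I` with `I_t ≠ 0` satisfies
`dim I_{t+1} > dim I_t` (`finrank_inf_lt_finrank_inf_succ`). Applied to `I = (F)` with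
`F ∈ ℱ_{t,ℓ}`, this provides `ℓ + 1` independent elements of `(F)` of degree `t + 1`; they are
killed by `Ann(F)`, so that `δ(t+1, ℓ+1) ≤ δ(t, ℓ)`. Omitting an element of `F` gives
`δ(t, ℓ) ≤ δ(t, ℓ+1)`. Hence `δ(·, ℓ)` is a nonincreasing sequence of natural numbers, which
stabilizes, and `s(ℓ) ≤ s(ℓ+1) ≤ δ(r+1, ℓ+1) ≤ δ(r, ℓ) = s(ℓ)` for `r = r(ℓ)`.

For the strict growth, suppose `dim I_{t+1} ≤ dim I_t` and `0 ≠ f ∈ I_t`. A generic linear form `x`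
over `K[X]` is regular (`exists_generic_linear_form`), so that multiplication by `x` from `I_t[X]`
to `I_{t+1}[X]` has torsion cokernel. Iterating, `R_j f` has dimension at most `dim I_t` for every
`j` (`finrank_map_mulRight_le`): the module `R f` has dimension at most one. This is impossible when
there is a regular sequence of length two (`eq_zero_of_polynomial_mul_eq`).

That the limits defining the multiplicities exist and are natural numbers
(`exists_tendsto_mult`) combines two facts. The Hilbert function of `R/I` is eventually polynomial
(`eventuallyPoly_hilbertFunction`), by Noetherian induction on `I` along the sequences
`0 → (R/(I : x))(-1) → R/I → R/(I + x) → 0`. The Hilbert–Samuel function of `R` is `O(t ^ dim R)`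
(`exists_sum_finrank_le`), by Noether normalization.
-/

/-! ### Eventually polynomial sequences -/

/-- An integer sequence is eventually polynomial if some iterated difference of it vanishes for
large arguments. -/
def EventuallyPoly (f : ℕ → ℤ) : Prop :=
  ∃ k : ℕ, ∀ᶠ t in atTop, (fwdDiff 1)^[k] f t = 0

namespace EventuallyPoly

theorem fwdDiff_iter_eventuallyEq {f g : ℕ → ℤ} (h : f =ᶠ[atTop] g) (k : ℕ) :
    (fwdDiff 1)^[k] f =ᶠ[atTop] (fwdDiff 1)^[k] g := by
  induction k with
  | zero => exact h
  | succ k ih =>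
    simp only [Function.iterate_succ_apply']
    filter_upwards [ih, (tendsto_add_atTop_nat 1).eventually ih] with t h1 h2
    simp only [fwdDiff, h1, h2]

theorem fwdDiff_iter_eventually_zero {f : ℕ → ℤ} {k m : ℕ} (hkm : k ≤ m)
    (h : ∀ᶠ t in atTop, (fwdDiff 1)^[k] f t = 0) : ∀ᶠ t in atTop, (fwdDiff 1)^[m] f t = 0 := by
  obtain ⟨j, rfl⟩ := Nat.exists_eq_add_of_le' hkm
  have h0 : (fwdDiff 1)^[k] f =ᶠ[atTop] (0 : ℕ → ℤ) := h
  have := fwdDiff_iter_eventuallyEq h0 j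
  rw [← Function.iterate_add_apply] at this
  filter_upwards [this] with t ht
  rw [ht]
  clear * -
  induction j generalizing t with
  | zero => rfl
  | succ j ih => rw [Function.iterate_succ_apply', fwdDiff, ih, ih, sub_zero]

theorem congr {f g : ℕ → ℤ} (hf : EventuallyPoly f) (h : f =ᶠ[atTop] g) : EventuallyPoly g := by
  obtain ⟨k, hk⟩ := hf
  refine ⟨k, ?_⟩
  filter_upwards [hk, fwdDiff_iter_eventuallyEq h k] with t h1 h2
  rw [← h2, h1]

theorem zero : EventuallyPoly fun _ => 0 := ⟨0, by simp⟩

theorem add {f g : ℕ → ℤ} (hf : EventuallyPoly f) (hg : EventuallyPoly g) :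
    EventuallyPoly fun t => f t + g t := by
  obtain ⟨k, hk⟩ := hf
  obtain ⟨m, hm⟩ := hg
  refine ⟨max k m, ?_⟩
  filter_upwards [fwdDiff_iter_eventually_zero (le_max_left k m) hk,
    fwdDiff_iter_eventually_zero (le_max_right k m) hm] with t h1 h2
  have := congr_fun (fwdDiff_iter_add (1 : ℕ) f g (max k m)) t
  simp only [Pi.add_apply, h1, h2, add_zero] at this
  exact this

theorem of_fwdDiff {f : ℕ → ℤ} (hf : EventuallyPoly fun t => f (t + 1) - f t) :
    EventuallyPoly f := by
  obtain ⟨k, hk⟩ := hf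
  exact ⟨k + 1, hk⟩

theorem comp_succ_iff {f : ℕ → ℤ} : EventuallyPoly (fun t => f (t + 1)) ↔ EventuallyPoly f := by
  have key (k t : ℕ) : (fwdDiff 1)^[k] (fun t => f (t + 1)) t = (fwdDiff 1)^[k] f (t + 1) := by
    induction k generalizing t with
    | zero => rfl
    | succ k ih => simp only [Function.iterate_succ_apply', fwdDiff, ih]
  refine exists_congr fun k => ?_
  simp only [key]
  conv_rhs => rw [← map_add_atTop_eq_nat 1, eventually_map]

theorem sum_range {f : ℕ → ℤ} (hf : EventuallyPoly f) :
    EventuallyPoly fun t => ∑ i ∈ Finset.range (t + 1), f i := by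
  apply of_fwdDiff
  simp only [Finset.sum_range_succ _ (_ + 1), add_sub_cancel_left]
  exact comp_succ_iff.2 hf

theorem tendsto_choose_sub_div_pow (N j k : ℕ) (hjk : j ≤ k) :
    Tendsto (fun t : ℕ => (((t - N).choose j : ℕ) : ℝ) / (t : ℝ) ^ k) atTop
      (𝓝 (if j = k then 1 / (k.factorial : ℝ) else 0)) := by
  have h1 : Tendsto (fun n : ℕ => ((n.choose j : ℕ) : ℝ) / (n : ℝ) ^ j) atTop
      (𝓝 (1 / (j.factorial : ℝ))) := by
    have h := isEquivalent_choose j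
    have hz : ∀ᶠ n : ℕ in atTop, ((n : ℝ) ^ j / j.factorial) ≠ 0 := by
      filter_upwards [eventually_gt_atTop 0] with n hn
      have : (0 : ℝ) < n := Nat.cast_pos.2 hn
      positivity
    have h2 := ((Asymptotics.isEquivalent_iff_tendsto_one hz).1 h).div_const (j.factorial : ℝ)
    refine h2.congr' ?_
    filter_upwards [eventually_gt_atTop 0] with n hn
    simp only [Pi.div_apply]
    field_simp
  have h2 : Tendsto (fun t : ℕ => (((t - N : ℕ) : ℝ) / (t : ℝ)) ) atTop (𝓝 1) := by
    have h := (tendsto_const_div_atTop_nhds_zero_nat (N : ℝ)).const_sub 1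
    rw [sub_zero] at h
    refine h.congr' ?_
    filter_upwards [eventually_gt_atTop N] with t ht
    have : (0 : ℝ) < t := Nat.cast_pos.2 (by omega)
    rw [Nat.cast_sub ht.le]
    field_simp
  have h3 : Tendsto (fun t : ℕ => (((t - N).choose j : ℕ) : ℝ) / (t : ℝ) ^ j) atTop
      (𝓝 (1 / (j.factorial : ℝ))) := by
    have h := (h1.comp (tendsto_sub_atTop_nat N)).mul (h2.pow j)
    rw [one_pow, mul_one] at h
    refine h.congr' ?_
    filter_upwards [eventually_gt_atTop N] with t ht
    have h0 : ((t - N : ℕ) : ℝ) ≠ 0 := by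
      have : 0 < t - N := by omega
      positivity
    simp only [Function.comp_apply, div_pow]
    field_simp
  rcases hjk.eq_or_lt with rfl | hlt
  · simpa using h3
  · have h4 : Tendsto (fun t : ℕ => ((t : ℝ) ^ (k - j))⁻¹) atTop (𝓝 0) :=
      (((tendsto_pow_atTop (by omega)).comp tendsto_natCast_atTop_atTop)).inv_tendsto_atTop
    have h := h3.mul h4
    rw [mul_zero] at h
    rw [if_neg hlt.ne]
    refine h.congr' ?_
    filter_upwards [eventually_gt_atTop 0] with t ht
    have : (t : ℝ) ^ k = (t : ℝ) ^ j * (t : ℝ) ^ (k - j) := by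
      rw [← pow_add]; congr 1; omega
    rw [this]
    field_simp

/-- The Gregory–Newton formula turns a sequence with vanishing `(k + 1)`-st differences into a
combination of binomial coefficients, whose leading term is read off. -/
theorem exists_tendsto_div_pow {f : ℕ → ℤ} {k : ℕ}
    (h : ∀ᶠ t in atTop, (fwdDiff 1)^[k + 1] f t = 0) :
    ∃ c : ℤ, (∀ᶠ t in atTop, (fwdDiff 1)^[k] f t = c) ∧
      Tendsto (fun t : ℕ => (f t : ℝ) / (t : ℝ) ^ k) atTop (𝓝 (c / k.factorial)) := by
  obtain ⟨N, hN⟩ := eventually_atTop.1 h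
  have hconst : ∀ t, N ≤ t → (fwdDiff 1)^[k] f t = (fwdDiff 1)^[k] f N := by
    intro t ht
    induction t, ht using Nat.le_induction with
    | base => rfl
    | succ t ht ih =>
      have := hN t ht
      rw [Function.iterate_succ_apply', fwdDiff, sub_eq_zero] at this
      rw [this, ih]
  have hz : ∀ j, k < j → (fwdDiff 1)^[j] f N = 0 := by
    intro j hj
    obtain ⟨i, rfl⟩ := Nat.exists_eq_add_of_le hj
    have : ∀ i t, N ≤ t → (fwdDiff 1)^[k + 1 + i] f t = 0 := by
      intro i
      induction i with
      | zero => exact hN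
      | succ i ih =>
        intro t ht
        rw [← add_assoc, Function.iterate_succ_apply', fwdDiff, ih _ ht, ih _ (by omega), sub_zero]
    exact this i N le_rfl
  refine ⟨(fwdDiff 1)^[k] f N, eventually_atTop.2 ⟨N, hconst⟩, ?_⟩
  have hsum : ∀ t, N ≤ t →
      f t = ∑ j ∈ Finset.range (k + 1), ((t - N).choose j : ℤ) * (fwdDiff 1)^[j] f N := by
    intro t ht
    have h1 := shift_eq_sum_fwdDiff_iter (1 : ℕ) f (t - N) N
    rw [smul_eq_mul, mul_one, Nat.add_sub_cancel' ht] at h1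
    simp only [nsmul_eq_mul] at h1
    rw [h1]
    trans ∑ j ∈ Finset.range (max (t - N) k + 1), ((t - N).choose j : ℤ) * (fwdDiff 1)^[j] f N
    · refine Finset.sum_subset (Finset.range_subset_range.2 (by omega)) fun j _ hj => ?_
      rw [Finset.mem_range] at hj
      rw [Nat.choose_eq_zero_of_lt (by omega)]
      simp
    · refine (Finset.sum_subset (Finset.range_subset_range.2 (by omega)) fun j _ hj => ?_).symm
      rw [Finset.mem_range] at hj
      rw [hz j (by omega), mul_zero]
  have hlim := tendsto_finsetSum (Finset.range (k + 1)) fun j hj =>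
    (tendsto_choose_sub_div_pow N j k (Nat.lt_succ_iff.1 (Finset.mem_range.1 hj))).mul_const
      (((fwdDiff 1)^[j] f N : ℤ) : ℝ)
  have hval : ∑ j ∈ Finset.range (k + 1),
      (if j = k then 1 / (k.factorial : ℝ) else 0) * (((fwdDiff 1)^[j] f N : ℤ) : ℝ) =
      (((fwdDiff 1)^[k] f N : ℤ) : ℝ) / k.factorial := by
    rw [Finset.sum_eq_single k (fun j _ hj => by rw [if_neg hj, zero_mul])
      (fun h => by simp at h)]
    rw [if_pos rfl]
    ring
  rw [hval] at hlim
  refine hlim.congr' ?_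
  filter_upwards [eventually_ge_atTop N] with t ht
  rw [hsum t ht, Int.cast_sum, Finset.sum_div]
  refine Finset.sum_congr rfl fun j _ => ?_
  push_cast
  ring

/-- An eventually polynomial sequence that is `O(t ^ d)` has a polynomial of degree at most `d`, so
that its normalized leading coefficient in degree `d` exists and is an integer. -/
theorem exists_tendsto_factorial_mul_div_pow {f : ℕ → ℤ} (hf : EventuallyPoly f) {d : ℕ}
    (hO : (fun t => (f t : ℝ)) =O[atTop] fun t : ℕ => (t : ℝ) ^ d) :
    ∃ c : ℤ, Tendsto (fun t : ℕ => (d.factorial * f t : ℝ) / (t : ℝ) ^ d) atTop (𝓝 c) := by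
  have key : ∀ᶠ t in atTop, (fwdDiff 1)^[d + 1] f t = 0 := by
    obtain ⟨k, hk⟩ := hf
    induction k with
    | zero => exact fwdDiff_iter_eventually_zero (Nat.zero_le _) hk
    | succ k ih =>
      rcases le_or_gt k d with hkd | hkd
      · exact fwdDiff_iter_eventually_zero (by omega) hk
      · apply ih
        obtain ⟨c, hc, hlim⟩ := exists_tendsto_div_pow hk
        have h0 : Tendsto (fun t : ℕ => (f t : ℝ) / (t : ℝ) ^ k) atTop (𝓝 0) := by
          refine (hO.trans_isLittleO ?_).tendsto_div_nhds_zero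
          exact (Asymptotics.isLittleO_pow_pow_atTop_of_lt (𝕜 := ℝ) hkd).comp_tendsto
            tendsto_natCast_atTop_atTop
        have hc0 := tendsto_nhds_unique hlim h0
        have : c = 0 := by
          have hk0 : (k.factorial : ℝ) ≠ 0 := by positivity
          rw [div_eq_zero_iff, or_iff_left hk0] at hc0
          exact_mod_cast hc0
        simpa [this] using hc
  obtain ⟨c, -, hlim⟩ := exists_tendsto_div_pow key
  refine ⟨c, ?_⟩
  have h := hlim.const_mul (d.factorial : ℝ)
  rw [mul_div_cancel₀ _ (by positivity)] at h
  exact h.congr fun t => by ring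

end EventuallyPoly

/-! ### Hilbert functions of quotients by homogeneous ideals -/

theorem Submodule.finrank_map_add_finrank_inf_ker {K V W : Type*} [Field K] [AddCommGroup V]
    [Module K V] [AddCommGroup W] [Module K W] (f : V →ₗ[K] W) (p : Submodule K V)
    [FiniteDimensional K p] :
    Module.finrank K (p.map f) + Module.finrank K (p ⊓ LinearMap.ker f : Submodule K V) =
      Module.finrank K p := by
  rw [← LinearMap.finrank_range_add_finrank_ker (f.domRestrict p), LinearMap.range_domRestrict,
    LinearMap.ker_domRestrict]
  rw [← Submodule.map_comap_subtype, Submodule.finrank_map_subtype_eq]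

namespace GMD.IsStandardGraded

variable {K R : Type*} [Field K] [CommRing R] [Algebra K R] {𝒜 : ℕ → Submodule K R}
  [GradedAlgebra 𝒜]

theorem pow_one_le (h𝒜 : IsStandardGraded 𝒜) (n : ℕ) : 𝒜 1 ^ n ≤ 𝒜 n := by
  induction n with
  | zero => rw [pow_zero, h𝒜.zero_eq]
  | succ n ih =>
    rw [pow_succ, Submodule.mul_le]
    intro x hx y hy
    exact SetLike.mul_mem_graded (ih hx) hy

/-- Every element is a sum of products of linear forms, and such a product of length `m` is
homogeneous of degree `m`. -/
theorem eq_pow_one (h𝒜 : IsStandardGraded 𝒜) (n : ℕ) : 𝒜 n = 𝒜 1 ^ n := by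
  refine le_antisymm (fun x hx => ?_) (h𝒜.pow_one_le n)
  have key : ∀ y : R, ∀ m, (DirectSum.decompose 𝒜 y m : R) ∈ 𝒜 1 ^ m := by
    intro y
    have hy : y ∈ Algebra.adjoin K (𝒜 1 : Set R) := h𝒜.adjoin_one ▸ Algebra.mem_top
    rw [← Subalgebra.mem_toSubmodule, Algebra.adjoin_eq_span] at hy
    induction hy using Submodule.span_induction with
    | mem y hy =>
      obtain ⟨j, hj⟩ : ∃ j, y ∈ 𝒜 1 ^ j := by
        induction hy using Submonoid.closure_induction with
        | mem y hy => exact ⟨1, by simpa using hy⟩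
        | one => exact ⟨0, by rw [pow_zero]; exact Submodule.one_le.1 le_rfl⟩
        | mul y z _ _ hy hz =>
          obtain ⟨i, hi⟩ := hy
          obtain ⟨j, hj⟩ := hz
          exact ⟨i + j, pow_add (𝒜 1) i j ▸ Submodule.mul_mem_mul hi hj⟩
      intro m
      have hj' := h𝒜.pow_one_le j hj
      by_cases hjm : j = m
      · subst hjm
        rwa [DirectSum.decompose_of_mem_same 𝒜 hj']
      · rw [DirectSum.decompose_of_mem_ne 𝒜 hj' hjm]
        exact zero_mem _
    | zero => simp
    | add y z _ _ hy hz =>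
      intro m
      simpa using add_mem (hy m) (hz m)
    | smul c y _ hy =>
      intro m
      rw [DirectSum.decompose_smul]
      exact Submodule.smul_mem _ c (hy m)
  simpa [DirectSum.decompose_of_mem_same 𝒜 hx] using key x n

theorem succ_eq (h𝒜 : IsStandardGraded 𝒜) (n : ℕ) : 𝒜 (n + 1) = 𝒜 1 * 𝒜 n := by
  rw [h𝒜.eq_pow_one (n + 1), pow_succ', ← h𝒜.eq_pow_one n]

theorem finiteDimensional (h𝒜 : IsStandardGraded 𝒜) (n : ℕ) : FiniteDimensional K (𝒜 n) := by
  rw [h𝒜.eq_pow_one n]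
  have := h𝒜.finite_one
  exact Module.Finite.iff_fg.2 ((Module.Finite.iff_fg.1 this).pow n)

theorem finiteType (h𝒜 : IsStandardGraded 𝒜) : Algebra.FiniteType K R := by
  have := h𝒜.finite_one
  obtain ⟨s, hs⟩ := Module.Finite.iff_fg.1 this
  refine ⟨s, ?_⟩
  rw [← h𝒜.adjoin_one, ← hs, Algebra.adjoin_span]

theorem isNoetherianRing (h𝒜 : IsStandardGraded 𝒜) : IsNoetherianRing R :=
  have := h𝒜.finiteType
  Algebra.FiniteType.isNoetherianRing K R

/-- In the exact sequence `0 → (R/(I : x))(-1) → R/I → R/(I + x) → 0` for a linear form `x`, the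
Hilbert functions add up. -/
theorem hilbertFunction_sup_span_singleton (h𝒜 : IsStandardGraded 𝒜) {I J : Ideal R}
    (hI : I.IsHomogeneous 𝒜) {x : R} (hx : x ∈ 𝒜 1) (hJ : ∀ r, r ∈ J ↔ x * r ∈ I) (t : ℕ) :
    hilbertFunction (quotientPieces 𝒜 I) (t + 1) =
      hilbertFunction (quotientPieces 𝒜 J) t +
        hilbertFunction (quotientPieces 𝒜 (I ⊔ Ideal.span {x})) (t + 1) := by
  have := h𝒜.finiteDimensional t
  have := h𝒜.finiteDimensional (t + 1)
  set mkI : R →ₗ[K] R ⧸ I := (Ideal.Quotient.mkₐ K I).toLinearMap with hmkI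
  let π : (R ⧸ I) →ₗ[K] R ⧸ (I ⊔ Ideal.span {x}) :=
    (Ideal.Quotient.factorₐ K (le_sup_left : I ≤ I ⊔ Ideal.span {x})).toLinearMap
  have h1 := Submodule.finrank_map_add_finrank_inf_ker (mkI ∘ₗ LinearMap.mulLeft K x) (𝒜 t)
  have h2 := Submodule.finrank_map_add_finrank_inf_ker (Ideal.Quotient.mkₐ K J).toLinearMap (𝒜 t)
  have h3 := Submodule.finrank_map_add_finrank_inf_ker π ((𝒜 (t + 1)).map mkI)
  have hker : LinearMap.ker (mkI ∘ₗ LinearMap.mulLeft K x) =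
      LinearMap.ker (Ideal.Quotient.mkₐ K J).toLinearMap := by
    ext r
    exact (Ideal.Quotient.eq_zero_iff_mem.trans (hJ r).symm).trans
      Ideal.Quotient.eq_zero_iff_mem.symm
  have hmap : ((𝒜 (t + 1)).map mkI).map π =
      (𝒜 (t + 1)).map (Ideal.Quotient.mkₐ K (I ⊔ Ideal.span {x})).toLinearMap := by
    rw [← Submodule.map_comp]
    rfl
  have hinf : (𝒜 (t + 1)).map mkI ⊓ LinearMap.ker π =
      (𝒜 t).map (mkI ∘ₗ LinearMap.mulLeft K x) := by
    apply le_antisymm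
    · rintro _ ⟨⟨r, hr, rfl⟩, hr'⟩
      have hr2 : r ∈ I ⊔ Ideal.span {x} := Ideal.Quotient.eq_zero_iff_mem.1 hr'
      obtain ⟨i, hi, y, hy, rfl⟩ := Submodule.mem_sup.1 hr2
      obtain ⟨s, rfl⟩ := Ideal.mem_span_singleton'.1 hy
      refine ⟨DirectSum.decompose 𝒜 s t, SetLike.coe_mem _, ?_⟩
      have h4 := DirectSum.decompose_of_mem_same 𝒜 hr
      rw [DirectSum.decompose_add, DirectSum.add_apply, Submodule.coe_add,
        DirectSum.coe_decompose_mul_add_of_right_mem 𝒜 hx] at h4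
      rw [← h4, map_add]
      have : mkI (DirectSum.decompose 𝒜 i (t + 1)) = 0 :=
        Ideal.Quotient.eq_zero_iff_mem.2 (hI (t + 1) hi)
      rw [this, zero_add, mul_comm]
      rfl
    · rintro _ ⟨s, hs, rfl⟩
      refine ⟨⟨x * s, ?_, rfl⟩, ?_⟩
      · rw [add_comm]
        exact SetLike.mul_mem_graded hx hs
      · refine Ideal.Quotient.eq_zero_iff_mem.2 (Ideal.mem_sup_right ?_)
        exact Ideal.mul_mem_right _ _ (Ideal.mem_span_singleton_self x)
  rw [hmap, hinf] at h3
  rw [hker] at h1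
  change Module.finrank K ((𝒜 (t + 1)).map mkI) =
    Module.finrank K ((𝒜 t).map (Ideal.Quotient.mkₐ K J).toLinearMap) + Module.finrank K
      ((𝒜 (t + 1)).map (Ideal.Quotient.mkₐ K (I ⊔ Ideal.span {x})).toLinearMap)
  omega

/-- Hilbert–Serre for cyclic modules, by Noetherian induction on the homogeneous ideal `I`: for a
linear form `x ∉ I`, both `I + (x)` and, unless `x` is regular modulo `I`, the colon ideal `I : x`
are strictly larger than `I`. -/
theorem eventuallyPoly_hilbertFunction (h𝒜 : IsStandardGraded 𝒜) (I : Ideal R)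
    (hI : I.IsHomogeneous 𝒜) :
    EventuallyPoly fun t => (hilbertFunction (quotientPieces 𝒜 I) t : ℤ) := by
  have := h𝒜.isNoetherianRing
  induction I using IsNoetherian.induction with
  | hgt I ih =>
  by_cases hlin : ∀ x ∈ 𝒜 1, x ∈ I
  · refine EventuallyPoly.zero.congr ?_
    filter_upwards [eventually_gt_atTop 0] with t ht
    obtain ⟨t, rfl⟩ := Nat.exists_eq_succ_of_ne_zero ht.ne'
    symm
    have hbot : quotientPieces 𝒜 I (t + 1) = ⊥ := by
      rw [quotientPieces, eq_bot_iff, Submodule.map_le_iff_le_comap, h𝒜.succ_eq, Submodule.mul_le]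
      intro x hx y _
      exact Ideal.Quotient.eq_zero_iff_mem.2 (Ideal.mul_mem_right _ I (hlin x hx))
    rw [Nat.cast_eq_zero, hilbertFunction, Nat.succ_eq_add_one, hbot, finrank_bot]
  · push Not at hlin
    obtain ⟨x, hx, hxI⟩ := hlin
    have hsup : EventuallyPoly fun t =>
        (hilbertFunction (quotientPieces 𝒜 (I ⊔ Ideal.span {x})) (t + 1) : ℤ) := by
      refine EventuallyPoly.comp_succ_iff (f := fun t =>
        (hilbertFunction (quotientPieces 𝒜 (I ⊔ Ideal.span {x})) t : ℤ)).2 (ih _ ?_ ?_)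
      · exact lt_of_le_of_ne le_sup_left fun h =>
          hxI (h ▸ Ideal.mem_sup_right (Ideal.mem_span_singleton_self x))
      · exact hI.sup (Ideal.homogeneous_span 𝒜 _ (by rintro _ rfl; exact ⟨1, hx⟩))
    let J : Ideal R := Submodule.comap (LinearMap.mulLeft R x) I
    have hJ : ∀ r, r ∈ J ↔ x * r ∈ I := fun r => Iff.rfl
    have hIJ : I ≤ J := fun r hr => Ideal.mul_mem_left I x hr
    have key := h𝒜.hilbertFunction_sup_span_singleton hI hx hJ
    rcases hIJ.eq_or_lt with hEq | hlt
    · rw [← hEq] at key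
      refine EventuallyPoly.of_fwdDiff (hsup.congr (Eventually.of_forall fun t => ?_))
      simp only [key t]
      push_cast
      ring
    · have hJhom : J.IsHomogeneous 𝒜 := by
        intro i r hr
        have h1 := hI (1 + i) ((hJ r).1 hr)
        rw [DirectSum.coe_decompose_mul_add_of_left_mem 𝒜 hx] at h1
        exact h1
      refine EventuallyPoly.comp_succ_iff.1 (((ih J hlt hJhom).add hsup).congr
        (Eventually.of_forall fun t => ?_))
      simp only [key t]
      push_cast
      ring

end GMD.IsStandardGraded

/-! ### Growth of the Hilbert function and existence of multiplicities -/

/-- Incomparability bounds the dimension of an integral extension above, going up bounds it below. -/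
theorem ringKrullDim_eq_of_isIntegral_of_injective {S R : Type*} [CommRing S] [CommRing R]
    [Algebra S R] [Algebra.IsIntegral S R] (hinj : Function.Injective (algebraMap S R)) :
    ringKrullDim R = ringKrullDim S := by
  apply le_antisymm
  · refine Order.krullDim_le_of_strictMono (PrimeSpectrum.comap (algebraMap S R)) fun p q hpq => ?_
    exact Ideal.IsIntegral.comap_lt_comap (show p.asIdeal < q.asIdeal from hpq)
  · refine iSup_le fun l => ?_
    have hfaith : FaithfulSMul S R := (faithfulSMul_iff_algebraMap_injective S R).2 hinj
    obtain ⟨P, hP, hPl⟩ := (inferInstance : Nonempty (Ideal.primesOver l.head.asIdeal R))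
    obtain ⟨L, hL, -⟩ := Ideal.exists_ltSeries_of_hasGoingUp l P
    rw [← hL]
    exact Order.LTSeries.length_le_krullDim L

section MonomialSpan

variable {K R : Type*} [Field K] [CommRing R] [Algebra K R] {s k : ℕ}

/-- The `K`-span of the products of the `m i` with the images under `g` of the monomials whose
exponents are all at most `n`. -/
def monomialSpan (g : MvPolynomial (Fin s) K →ₐ[K] R) (m : Fin k → R) (n : ℕ) : Submodule K R :=
  Submodule.span K
    {r | ∃ (a : Fin s →₀ ℕ) (i : Fin k), (∀ j, a j ≤ n) ∧ r = g (MvPolynomial.monomial a 1) * m i}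

variable (g : MvPolynomial (Fin s) K →ₐ[K] R) (m : Fin k → R)

theorem monomialSpan_mono : Monotone (monomialSpan g m) := fun _ _ h =>
  Submodule.span_mono fun _ ⟨a, i, ha, hr⟩ => ⟨a, i, fun j => (ha j).trans h, hr⟩

theorem finrank_monomialSpan_le (n : ℕ) :
    FiniteDimensional K (monomialSpan g m n) ∧
      Module.finrank K (monomialSpan g m n) ≤ k * (n + 1) ^ s := by
  let v : Fin k × (Fin s → Fin (n + 1)) → R := fun p =>
    g (MvPolynomial.monomial (Finsupp.equivFunOnFinite.symm fun j => (p.2 j : ℕ)) 1) * m p.1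
  have hle : monomialSpan g m n ≤ Submodule.span K (Set.range v) := by
    refine Submodule.span_mono ?_
    rintro _ ⟨a, i, ha, rfl⟩
    refine ⟨(i, fun j => ⟨a j, Nat.lt_succ_of_le (ha j)⟩), ?_⟩
    have : (Finsupp.equivFunOnFinite.symm fun j => a j) = a := Finsupp.ext fun j => rfl
    simp only [v, this]
  have hfin : FiniteDimensional K (Submodule.span K (Set.range v)) :=
    FiniteDimensional.span_of_finite K (Set.finite_range v)
  refine ⟨Submodule.finiteDimensional_of_le hle, (Submodule.finrank_mono hle).trans ?_⟩
  refine (finrank_range_le_card v).trans ?_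
  simp

theorem monomial_mul_mem_monomialSpan {n n' : ℕ} {a : Fin s →₀ ℕ} (ha : ∀ j, a j ≤ n) {r : R}
    (hr : r ∈ monomialSpan g m n') :
    g (MvPolynomial.monomial a 1) * r ∈ monomialSpan g m (n + n') := by
  induction hr using Submodule.span_induction with
  | mem r hr =>
    obtain ⟨b, i, hb, rfl⟩ := hr
    refine Submodule.subset_span ⟨a + b, i, fun j => add_le_add (ha j) (hb j), ?_⟩
    rw [← mul_assoc, ← map_mul, MvPolynomial.monomial_mul, one_mul]
  | zero => simp
  | add x y _ _ hx hy => rw [mul_add]; exact add_mem hx hy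
  | smul c x _ hx => rw [mul_smul_comm]; exact Submodule.smul_mem _ c hx

theorem exists_le_monomialSpan (hm : ∀ r, ∃ p : Fin k → MvPolynomial (Fin s) K,
    r = ∑ i, g (p i) * m i) {U : Submodule K R} (hU : U.FG) : ∃ n, U ≤ monomialSpan g m n := by
  have hmem (r : R) : ∃ n, r ∈ monomialSpan g m n := by
    obtain ⟨p, rfl⟩ := hm r
    refine ⟨Finset.univ.sup fun i => (p i).totalDegree, Submodule.sum_mem _ fun i _ => ?_⟩
    rw [(p i).as_sum, map_sum, Finset.sum_mul]
    refine Submodule.sum_mem _ fun a ha => ?_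
    rw [← mul_one ((p i).coeff a), ← smul_eq_mul ((p i).coeff a), ← MvPolynomial.smul_monomial,
      map_smul, smul_mul_assoc]
    refine Submodule.smul_mem _ _ (Submodule.subset_span ⟨a, i, fun j => ?_, rfl⟩)
    refine le_trans ?_ (Finset.le_sup (f := fun i => (p i).totalDegree) (Finset.mem_univ i))
    exact (MvPolynomial.monomial_le_degreeOf j ha).trans (MvPolynomial.degreeOf_le_totalDegree _ _)
  obtain ⟨S, rfl⟩ := hU
  choose N hN using hmem
  exact ⟨S.sup N, Submodule.span_le.2 fun r hr =>
    monomialSpan_mono g m (Finset.le_sup (f := N) hr) (hN r)⟩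

end MonomialSpan

namespace GMD

variable {K R : Type*} [Field K] [CommRing R] [Algebra K R] {𝒜 : ℕ → Submodule K R}
  [GradedAlgebra 𝒜]

theorem finrank_iSup_range [∀ n, FiniteDimensional K (𝒜 n)] (n : ℕ) :
    Module.finrank K (⨆ i ∈ Finset.range n, 𝒜 i : Submodule K R) =
      ∑ i ∈ Finset.range n, Module.finrank K (𝒜 i) := by
  induction n with
  | zero =>
    have hbot : (⨆ i ∈ Finset.range 0, 𝒜 i) = ⊥ := by simp
    rw [hbot, finrank_bot, Finset.sum_range_zero]
  | succ n ih =>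
    have hfin : FiniteDimensional K (⨆ i ∈ Finset.range n, 𝒜 i : Submodule K R) := by
      rw [← Finset.sup_eq_iSup]
      infer_instance
    have hdisj := (DirectSum.Decomposition.isInternal 𝒜).submodule_iSupIndep.disjoint_biSup
      (x := n) (y := (Finset.range n : Set ℕ)) (by simp)
    have h := Submodule.finrank_sup_add_finrank_inf_eq (𝒜 n)
      (⨆ i ∈ Finset.range n, 𝒜 i : Submodule K R)
    have hbot : 𝒜 n ⊓ (⨆ i ∈ Finset.range n, 𝒜 i) = ⊥ := hdisj.eq_bot
    rw [hbot, finrank_bot] at h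
    rw [Finset.range_add_one, Finset.iSup_insert, Finset.sum_insert (by simp), ← ih]
    simpa using h

namespace IsStandardGraded

/-- The Hilbert–Samuel function of `R` grows at most like `t ^ dim R`: by Noether normalization `R`
is a finite module over a polynomial ring in `dim R` variables, and multiplication by linear forms
raises the exponents of the monomials of that ring by a bounded amount. -/
theorem exists_sum_finrank_le (h𝒜 : IsStandardGraded 𝒜) :
    ∃ k c : ℕ, ∀ t, ∑ i ∈ Finset.range (t + 1), Module.finrank K (𝒜 i) ≤
      k * (c * (t + 1) + 1) ^ dim R := by
  have := h𝒜.nontrivial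
  have := h𝒜.finiteType
  have := h𝒜.finiteDimensional
  obtain ⟨s, g, hinj, hfin⟩ := exists_finite_inj_algHom_of_fg K R
  have hdim : dim R = s := by
    let _ : Algebra (MvPolynomial (Fin s) K) R := g.toRingHom.toAlgebra
    have : Module.Finite (MvPolynomial (Fin s) K) R := hfin
    have h1 := ringKrullDim_eq_of_isIntegral_of_injective (S := MvPolynomial (Fin s) K) (R := R) hinj
    rw [MvPolynomial.ringKrullDim_of_isNoetherianRing, ringKrullDim_eq_zero_of_field] at h1
    simp only [dim, h1]
    simp
  obtain ⟨k, m, hm⟩ : ∃ (k : ℕ) (m : Fin k → R), ∀ r, ∃ p : Fin k → MvPolynomial (Fin s) K,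
      r = ∑ i, g (p i) * m i := by
    let _ : Algebra (MvPolynomial (Fin s) K) R := g.toRingHom.toAlgebra
    have : Module.Finite (MvPolynomial (Fin s) K) R := hfin
    obtain ⟨k, m, hm⟩ := Module.Finite.exists_fin (R := MvPolynomial (Fin s) K) (M := R)
    refine ⟨k, m, fun r => ?_⟩
    obtain ⟨p, hp⟩ := (Submodule.mem_span_range_iff_exists_fun _).1 (hm ▸ Submodule.mem_top (x := r))
    exact ⟨p, hp.symm⟩
  obtain ⟨c, hc⟩ := exists_le_monomialSpan g m hm
    (U := 1 ⊔ 𝒜 1 * Submodule.span K (Set.range m))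
    (Submodule.FG.sup ⟨{1}, by simp [Submodule.one_eq_span]⟩
      ((Module.Finite.iff_fg.1 (this 1)).mul (Submodule.fg_span (Set.finite_range m))))
  -- `c` bounds the exponents needed for `1` and for a linear form times a module generator.
  have hle (t : ℕ) : 𝒜 t ≤ monomialSpan g m (c * (t + 1)) := by
    induction t with
    | zero =>
      rw [h𝒜.zero_eq, zero_add, mul_one]
      exact le_sup_left.trans hc
    | succ t ih =>
      rw [h𝒜.succ_eq]
      refine Submodule.mul_le.2 fun y hy w hw => ?_
      replace hw := ih hw
      induction hw using Submodule.span_induction with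
      | mem w hw =>
        obtain ⟨a, i, ha, rfl⟩ := hw
        rw [mul_left_comm, mul_add_one c (t + 1)]
        refine monomial_mul_mem_monomialSpan g m ha (hc (Submodule.mem_sup_right ?_))
        exact Submodule.mul_mem_mul hy (Submodule.subset_span ⟨i, rfl⟩)
      | zero => simp
      | add u v _ _ hu hv => rw [mul_add y u v]; exact add_mem hu hv
      | smul b x _ hx => rw [mul_smul_comm]; exact Submodule.smul_mem _ b hx
  refine ⟨k, c, fun t => ?_⟩
  have hW := finrank_monomialSpan_le g m (c * (t + 1))
  have := hW.1
  rw [← finrank_iSup_range, hdim]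
  refine (Submodule.finrank_mono (iSup₂_le fun i hi => ?_)).trans hW.2
  refine (hle i).trans (monomialSpan_mono g m ?_)
  rw [Finset.mem_range] at hi
  gcongr
  omega

theorem finrank_quotientPieces_le (h𝒜 : IsStandardGraded 𝒜) (I : Ideal R) (t : ℕ) :
    hilbertFunction (quotientPieces 𝒜 I) t ≤ Module.finrank K (𝒜 t) :=
  have := h𝒜.finiteDimensional t
  Submodule.finrank_map_le _ _

/-- The limit that defines the multiplicity of `R/I` exists and is a natural number. -/
theorem exists_tendsto_mult (h𝒜 : IsStandardGraded 𝒜) {I : Ideal R} (hI : I.IsHomogeneous 𝒜) :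
    ∃ n : ℕ, Tendsto (fun t : ℕ => ((dim R).factorial * ∑ i ∈ Finset.range (t + 1),
      (hilbertFunction (quotientPieces 𝒜 I) i : ℝ)) / (t : ℝ) ^ dim R) atTop (𝓝 n) := by
  obtain ⟨k, c, hkc⟩ := h𝒜.exists_sum_finrank_le
  have hO : (fun t => ((∑ i ∈ Finset.range (t + 1),
      (hilbertFunction (quotientPieces 𝒜 I) i : ℤ) : ℤ) : ℝ)) =O[atTop]
      fun t : ℕ => (t : ℝ) ^ dim R := by
    refine Asymptotics.IsBigO.of_bound (k * (2 * c + 1) ^ dim R) ?_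
    filter_upwards [eventually_ge_atTop 1] with t ht
    have h1 : ∑ i ∈ Finset.range (t + 1), hilbertFunction (quotientPieces 𝒜 I) i ≤
        k * (2 * c + 1) ^ dim R * t ^ dim R := by
      refine ((Finset.sum_le_sum fun i _ => h𝒜.finrank_quotientPieces_le I i).trans (hkc t)).trans ?_
      rw [mul_assoc, ← mul_pow]
      gcongr
      nlinarith
    rw [Real.norm_of_nonneg (by positivity), Real.norm_of_nonneg (by positivity)]
    exact_mod_cast h1
  obtain ⟨n, hn⟩ := (h𝒜.eventuallyPoly_hilbertFunction I hI).sum_range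
    |>.exists_tendsto_factorial_mul_div_pow hO
  have hn0 : (0 : ℝ) ≤ n := ge_of_tendsto' hn fun t => by positivity
  obtain ⟨n, rfl⟩ := Int.eq_ofNat_of_zero_le (Int.cast_nonneg_iff.1 hn0)
  refine ⟨n, ?_⟩
  simpa using hn

theorem exists_mult_quotientPieces_eq (h𝒜 : IsStandardGraded 𝒜) {I : Ideal R}
    (hI : I.IsHomogeneous 𝒜) : ∃ n : ℕ, mult R (quotientPieces 𝒜 I) = n := by
  obtain ⟨n, hn⟩ := h𝒜.exists_tendsto_mult hI
  exact ⟨n, hn.limUnder_eq⟩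

theorem mult_quotientPieces_anti (h𝒜 : IsStandardGraded 𝒜) {I J : Ideal R}
    (hI : I.IsHomogeneous 𝒜) (hJ : J.IsHomogeneous 𝒜) (hIJ : I ≤ J) :
    mult R (quotientPieces 𝒜 J) ≤ mult R (quotientPieces 𝒜 I) := by
  obtain ⟨n, hn⟩ := h𝒜.exists_tendsto_mult hI
  obtain ⟨m, hm⟩ := h𝒜.exists_tendsto_mult hJ
  rw [mult, mult, hn.limUnder_eq, hm.limUnder_eq]
  refine le_of_tendsto_of_tendsto' hm hn fun t => ?_
  gcongr with i
  have := h𝒜.finiteDimensional i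
  have hmap : quotientPieces 𝒜 J i =
      (quotientPieces 𝒜 I i).map (Ideal.Quotient.factorₐ K hIJ).toLinearMap := by
    rw [quotientPieces, quotientPieces, ← Submodule.map_comp]
    rfl
  have : FiniteDimensional K (quotientPieces 𝒜 I i) := by
    rw [quotientPieces]; infer_instance
  rw [hilbertFunction, hilbertFunction, hmap]
  exact Submodule.finrank_map_le _ _

theorem mult_quotientPieces_bot (h𝒜 : IsStandardGraded 𝒜) :
    mult R (quotientPieces 𝒜 ⊥) = mult R 𝒜 := by
  have h (t : ℕ) : hilbertFunction (quotientPieces 𝒜 ⊥) t = hilbertFunction 𝒜 t := by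
    have := h𝒜.finiteDimensional t
    refine (LinearEquiv.finrank_eq (Submodule.equivMapOfInjective
      (Ideal.Quotient.mkₐ K (⊥ : Ideal R)).toLinearMap ?_ (𝒜 t))).symm
    intro x y hxy
    have := Ideal.Quotient.eq.1 hxy
    rwa [Ideal.mem_bot, sub_eq_zero] at this
  simp only [mult, h]

end IsStandardGraded
end GMD

/-! ### Torsion and rank over a polynomial ring -/

section Saturation

variable {A M : Type*} [CommRing A] [IsDomain A] [AddCommGroup M] [Module A M]

/-- The elements of `M` that a nonzero scalar multiplies into `N`, i.e. the preimage of the torsion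
of `M ⧸ N`. -/
def Submodule.saturation (N : Submodule A M) : Submodule A M where
  carrier := {x | ∃ a : A, a ≠ 0 ∧ a • x ∈ N}
  zero_mem' := ⟨1, one_ne_zero, by simp⟩
  add_mem' := by
    rintro x y ⟨a, ha, hx⟩ ⟨b, hb, hy⟩
    refine ⟨a * b, mul_ne_zero ha hb, ?_⟩
    rw [smul_add, mul_comm a b, mul_smul, mul_comm b a, mul_smul]
    exact N.add_mem (N.smul_mem b hx) (N.smul_mem a hy)
  smul_mem' := by
    rintro c x ⟨a, ha, hx⟩
    exact ⟨a, ha, smul_comm a c x ▸ N.smul_mem c hx⟩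

/-- The rank of a submodule bounds the rank of its saturation. -/
theorem LinearIndependent.card_le_of_mem_saturation {ι κ : Type*} [Fintype ι] [Fintype κ]
    {u : ι → M} (hu : LinearIndependent A u) {e : κ → M}
    (h : ∀ i, u i ∈ (Submodule.span A (Set.range e)).saturation) :
    Fintype.card ι ≤ Fintype.card κ := by
  classical
  choose a ha hau using h
  have hind : LinearIndependent A fun i => a i • u i := by
    rw [Fintype.linearIndependent_iff] at hu ⊢
    intro c hc i
    have := hu (fun i => c i * a i) (by simpa [mul_smul] using hc) i
    exact (mul_eq_zero.1 this).resolve_right (ha i)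
  have h1 := linearIndependent_le_span' (fun i => a i • u i) hind (Set.range e)
    (by rintro _ ⟨i, rfl⟩; exact hau i)
  rw [Cardinal.mk_fintype, Nat.cast_le] at h1
  exact h1.trans (Fintype.card_range_le e)

end Saturation

section PolynomialExtension

open Polynomial

attribute [local instance] Polynomial.algebra

variable {K R : Type*} [Field K] [CommRing R] [Algebra K R]

theorem LinearIndependent.polynomial_C {ι : Type*} [Fintype ι] {u : ι → R}
    (hu : LinearIndependent K u) : LinearIndependent K[X] fun i => (C (u i) : R[X]) := by
  rw [Fintype.linearIndependent_iff] at hu ⊢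
  intro p hp i
  ext n
  refine hu (fun i => (p i).coeff n) ?_ i
  have := congr_arg (fun q => q.coeff n) hp
  simpa [Algebra.smul_def, finsetSum_coeff] using this

/-- The polynomials in `R[X]` with coefficients in the `K`-subspace `V` of `R`, as the
`K[X]`-submodule spanned by the constants in `V`. -/
noncomputable def polySpan (V : Submodule K R) : Submodule K[X] R[X] :=
  Submodule.span K[X] ((C : R →+* R[X]) '' (V : Set R))

theorem C_mem_polySpan {V : Submodule K R} {v : R} (hv : v ∈ V) : (C v : R[X]) ∈ polySpan V :=
  Submodule.subset_span ⟨v, hv, rfl⟩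

theorem smul_C_eq (c : K) (r : R) : (C (c • r) : R[X]) = (C c : K[X]) • (C r : R[X]) := by
  simp [Algebra.smul_def]

theorem polySpan_span_range {ι : Type*} (e : ι → R) :
    polySpan (Submodule.span K (Set.range e)) =
      Submodule.span K[X] (Set.range fun i => (C (e i) : R[X])) := by
  apply le_antisymm
  · refine Submodule.span_le.2 ?_
    rintro _ ⟨v, hv, rfl⟩
    induction hv using Submodule.span_induction with
    | mem v hv =>
      obtain ⟨i, rfl⟩ := hv
      exact Submodule.subset_span ⟨i, rfl⟩
    | zero => simp
    | add v w _ _ hv hw => rw [map_add]; exact add_mem hv hw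
    | smul c v _ hv => rw [smul_C_eq]; exact Submodule.smul_mem _ _ hv
  · refine Submodule.span_le.2 ?_
    rintro _ ⟨i, rfl⟩
    exact C_mem_polySpan (Submodule.subset_span ⟨i, rfl⟩)

theorem polySpan_eq_span_finBasis (V : Submodule K R) [FiniteDimensional K V] :
    polySpan V = Submodule.span K[X]
      (Set.range fun i => (C (Module.finBasis K V i : R) : R[X])) := by
  rw [← polySpan_span_range]
  congr 1
  have := congr_arg (Submodule.map V.subtype) (Module.finBasis K V).span_eq
  rw [Submodule.map_span, Submodule.map_subtype_top, ← Set.range_comp] at this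
  exact this.symm

theorem mul_mem_polySpan {U V W : Submodule K R} (h : U * V ≤ W) {p q : R[X]}
    (hp : p ∈ polySpan U) (hq : q ∈ polySpan V) : p * q ∈ polySpan W := by
  induction hp using Submodule.span_induction with
  | mem p hp =>
    obtain ⟨u, hu, rfl⟩ := hp
    induction hq using Submodule.span_induction with
    | mem q hq =>
      obtain ⟨v, hv, rfl⟩ := hq
      rw [← map_mul]
      exact C_mem_polySpan (h (Submodule.mul_mem_mul hu hv))
    | zero => simp
    | add p q _ _ hp hq => rw [mul_add]; exact add_mem hp hq
    | smul c q _ hq => rw [mul_smul_comm]; exact Submodule.smul_mem _ c hq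
  | zero => simp
  | add p q _ _ hp hq => rw [add_mul]; exact add_mem hp hq
  | smul c p _ hp => rw [smul_mul_assoc]; exact Submodule.smul_mem _ c hp

/-- If a regular element `x` of `R[X]` multiplies `V[X]` into `W[X]` and `dim W ≤ dim V`, then
comparing ranks over `K[X]` shows that `W[X] / x V[X]` is torsion. -/
theorem C_mem_saturation_of_finrank_le {V W : Submodule K R} [FiniteDimensional K V]
    [FiniteDimensional K W] (hVW : Module.finrank K W ≤ Module.finrank K V) {x : R[X]}
    (hx : x ∈ nonZeroDivisors R[X]) (hxV : ∀ v ∈ V, x * C v ∈ polySpan W) {w : R} (hw : w ∈ W) :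
    (C w : R[X]) ∈ ((polySpan V).map (LinearMap.mulLeft K[X] x)).saturation := by
  let e : Fin (Module.finrank K V) → R := fun i => Module.finBasis K V i
  have he : LinearIndependent K e :=
    (Module.finBasis K V).linearIndependent.map' V.subtype V.ker_subtype
  -- The `dim V + 1` vectors `C w` and `x * C (e i)` lie in the module `W[X]` of rank at most `dim V`.
  let u : Option (Fin (Module.finrank K V)) → R[X] := fun o => o.elim (C w) fun i => x * C (e i)
  have hu (o) : u o ∈ (Submodule.span K[X]
      (Set.range fun i => (C (Module.finBasis K W i : R) : R[X]))).saturation := by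
    rw [← polySpan_eq_span_finBasis]
    refine ⟨1, one_ne_zero, ?_⟩
    rw [one_smul]
    cases o with
    | none => exact C_mem_polySpan hw
    | some i => exact hxV _ (SetLike.coe_mem _)
  have hdep : ¬ LinearIndependent K[X] u := fun h => by
    have := h.card_le_of_mem_saturation hu
    simp only [Fintype.card_option, Fintype.card_fin] at this
    omega
  rw [Fintype.not_linearIndependent_iff] at hdep
  obtain ⟨p, hp, o, ho⟩ := hdep
  rw [Fintype.sum_option] at hp
  have hsum : ∑ i, p (some i) • u (some i) = x * ∑ i, p (some i) • C (e i) := by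
    rw [Finset.mul_sum]
    exact Finset.sum_congr rfl fun i _ => (mul_smul_comm _ _ _).symm
  rw [hsum] at hp
  refine ⟨p none, fun h0 => ho ?_, ?_⟩
  · rw [h0, zero_smul, zero_add] at hp
    have h1 : ∑ i, p (some i) • (C (e i) : R[X]) = 0 := by
      exact (mul_right_mem_nonZeroDivisors_eq_zero_iff hx).1 (mul_comm x _ ▸ hp)
    cases o with
    | none => exact h0
    | some i => exact Fintype.linearIndependent_iff.1 he.polynomial_C _ h1 i
  · refine ⟨-∑ i, p (some i) • C (e i), ?_, ?_⟩
    · exact neg_mem (Submodule.sum_mem _ fun i _ =>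
        Submodule.smul_mem _ _ (C_mem_polySpan (SetLike.coe_mem _)))
    · rw [LinearMap.mulLeft_apply, mul_neg]
      exact (eq_neg_of_add_eq_zero_left hp).symm

end PolynomialExtension

/-! ### The generic linear form -/

namespace GMD

open Polynomial

attribute [local instance] Polynomial.algebra

variable {K R : Type*} [Field K] [CommRing R] [Algebra K R] {𝒜 : ℕ → Submodule K R}
  [GradedAlgebra 𝒜]

namespace IsStandardGraded

theorem mul_eq_zero_of_mem_irrelevant (h𝒜 : IsStandardGraded 𝒜) {c : R}
    (hc : ∀ y ∈ 𝒜 1, c * y = 0) {a : R}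
    (ha : a ∈ (HomogeneousIdeal.irrelevant 𝒜).toIdeal) : c * a = 0 := by
  classical
  have h0 : (DirectSum.decompose 𝒜 a 0 : R) = 0 := ha
  rw [← DirectSum.sum_support_decompose 𝒜 a, Finset.mul_sum]
  refine Finset.sum_eq_zero fun i _ => ?_
  cases i with
  | zero => rw [h0, mul_zero]
  | succ i =>
    have h1 : 𝒜 (i + 1) ≤ LinearMap.ker (LinearMap.mulLeft K c) := by
      rw [h𝒜.succ_eq, Submodule.mul_le]
      intro y hy z _
      rw [LinearMap.mem_ker, LinearMap.mulLeft_apply, ← mul_assoc, hc y hy, zero_mul]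
    exact h1 (SetLike.coe_mem _)

/-- McCoy's theorem makes the generic linear form `∑ xᵢ Xⁱ`, for a basis `xᵢ` of `R₁`, regular on
`R[X]` as soon as the irrelevant ideal contains a regular element. It replaces the linear
nonzerodivisor that may fail to exist over a finite field `K`. -/
theorem exists_generic_linear_form (h𝒜 : IsStandardGraded 𝒜) {a : R}
    (ha : a ∈ (HomogeneousIdeal.irrelevant 𝒜).toIdeal) (hreg : ∀ r, a * r = 0 → r = 0) :
    ∃ x ∈ nonZeroDivisors R[X], x ∈ polySpan (𝒜 1) := by
  have := h𝒜.finite_one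
  let e : Fin (Module.finrank K (𝒜 1)) → R := fun i => Module.finBasis K (𝒜 1) i
  refine ⟨∑ i : Fin (Module.finrank K (𝒜 1)), (X ^ (i : ℕ) : K[X]) • C (e i), ?_,
    Submodule.sum_mem _ fun i _ => Submodule.smul_mem _ _ (C_mem_polySpan (SetLike.coe_mem _))⟩
  by_contra hx
  rw [Polynomial.notMem_nonZeroDivisors_iff] at hx
  obtain ⟨c, hc0, hc⟩ := hx
  have hce (i) : c * e i = 0 := by
    have := congr_arg (fun q : R[X] => q.coeff (i : ℕ)) hc
    simpa [Algebra.smul_def, finsetSum_coeff, coeff_X_pow_mul', coeff_C, coeff_X_pow,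
      Fin.val_inj] using this
  refine hc0 (hreg c ?_)
  rw [mul_comm]
  refine h𝒜.mul_eq_zero_of_mem_irrelevant (fun y hy => ?_) ha
  have h1 := congr_arg Subtype.val ((Module.finBasis K (𝒜 1)).sum_repr ⟨y, hy⟩)
  rw [← show _ = y from h1]
  simp only [Submodule.coe_sum, Submodule.coe_smul, Finset.mul_sum, mul_smul_comm]
  exact Finset.sum_eq_zero fun i _ => by rw [show c * _ = 0 from hce i, smul_zero]

/-- If an ideal `I` does not grow from degree `t` to degree `t + 1`, then the Hilbert function of
every principal ideal generated by some `f ∈ I_t` is bounded by `dim I_t`: after multiplication by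
nonzero elements of `K[X]`, the elements of `R_j f` lie in `x ^ j I_t[X]`, where `x` is the generic
linear form. -/
theorem finrank_map_mulRight_le (h𝒜 : IsStandardGraded 𝒜) {a : R}
    (ha : a ∈ (HomogeneousIdeal.irrelevant 𝒜).toIdeal) (hreg : ∀ r, a * r = 0 → r = 0)
    {I : Ideal R} {t : ℕ}
    (hI : Module.finrank K (𝒜 (t + 1) ⊓ I.restrictScalars K : Submodule K R) ≤
      Module.finrank K (𝒜 t ⊓ I.restrictScalars K : Submodule K R))
    {f : R} (hf : f ∈ 𝒜 t) (hfI : f ∈ I) (j : ℕ) :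
    Module.finrank K ((𝒜 j).map (LinearMap.mulRight K f)) ≤
      Module.finrank K (𝒜 t ⊓ I.restrictScalars K : Submodule K R) := by
  have := h𝒜.finiteDimensional
  obtain ⟨x, hx, hx1⟩ := h𝒜.exists_generic_linear_form ha hreg
  set V := 𝒜 t ⊓ I.restrictScalars K with hV
  set W := 𝒜 (t + 1) ⊓ I.restrictScalars K with hW
  have hVW : 𝒜 1 * V ≤ W := Submodule.mul_le.2 fun y hy v hv =>
    ⟨add_comm 1 t ▸ SetLike.mul_mem_graded hy hv.1, I.mul_mem_left y hv.2⟩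
  have htors (w) (hw : w ∈ W) := C_mem_saturation_of_finrank_le hI hx
    (fun v hv => mul_mem_polySpan hVW hx1 (C_mem_polySpan hv)) hw
  have key (r) (hr : r ∈ 𝒜 j) :
      (C (r * f) : R[X]) ∈ ((polySpan V).map (LinearMap.mulLeft K[X] (x ^ j))).saturation := by
    induction j generalizing r with
    | zero =>
      rw [h𝒜.zero_eq] at hr
      obtain ⟨c, rfl⟩ := Submodule.mem_one.1 hr
      refine ⟨1, one_ne_zero, C (algebraMap K R c * f), ?_, by simp⟩
      rw [← Algebra.smul_def]
      exact C_mem_polySpan (V.smul_mem c ⟨hf, hfI⟩)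
    | succ j ih =>
      rw [h𝒜.succ_eq] at hr
      induction hr using Submodule.mul_induction_on' with
      | mem_mul_mem y hy r hr =>
        obtain ⟨D, hD, p, hp, hDp⟩ := ih r hr
        rw [LinearMap.mulLeft_apply] at hDp
        obtain ⟨D', hD', q, hq, hDq⟩ : C y * p ∈
            ((polySpan V).map (LinearMap.mulLeft K[X] x)).saturation := by
          have h1 : polySpan W ≤ ((polySpan V).map (LinearMap.mulLeft K[X] x)).saturation := by
            refine Submodule.span_le.2 ?_
            rintro _ ⟨w, hw, rfl⟩
            exact htors w hw
          exact h1 (mul_mem_polySpan hVW (C_mem_polySpan hy) hp)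
        rw [LinearMap.mulLeft_apply] at hDq
        refine ⟨D' * D, mul_ne_zero hD' hD, q, hq, ?_⟩
        rw [LinearMap.mulLeft_apply, mul_assoc y, map_mul, mul_smul, ← mul_smul_comm D, ← hDp,
          pow_succ, mul_assoc, hDq, mul_smul_comm, mul_left_comm]
      | add r _ s _ hr hs =>
        rw [add_mul, map_add]
        exact add_mem hr hs
  let e : Fin (Module.finrank K V) → R[X] := fun i => x ^ j * C (Module.finBasis K V i : R)
  have hspan : (polySpan V).map (LinearMap.mulLeft K[X] (x ^ j)) =
      Submodule.span K[X] (Set.range e) := by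
    rw [polySpan_eq_span_finBasis, Submodule.map_span, ← Set.range_comp]
    rfl
  rw [hspan] at key
  set U := (𝒜 j).map (LinearMap.mulRight K f) with hU
  have hu : LinearIndependent K fun i => (Module.finBasis K U i : R) :=
    (Module.finBasis K U).linearIndependent.map' U.subtype U.ker_subtype
  have := hu.polynomial_C.card_le_of_mem_saturation (e := e) fun i => by
    obtain ⟨r, hr, hri⟩ := (Module.finBasis K U i).2
    rw [← hri]
    exact key r hr
  simpa using this

end IsStandardGraded
end GMD

/-! ### Strict growth of ideals in depth at least two -/

namespace GMD

open Polynomial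

variable {K R : Type*} [Field K] [CommRing R] [Algebra K R] {𝒜 : ℕ → Submodule K R}
  [GradedAlgebra 𝒜]

/-- The form in which the depth hypothesis is used: `a` is regular on `R`, and `b` on `R/aR`. -/
theorem exists_regular_pair (h : 2 ≤ depth 𝒜) : ∃ a b : R,
    a ∈ (HomogeneousIdeal.irrelevant 𝒜).toIdeal ∧ b ∈ (HomogeneousIdeal.irrelevant 𝒜).toIdeal ∧
      (∀ r, a * r = 0 → r = 0) ∧ ∀ r, a ∣ b * r → a ∣ r := by
  obtain ⟨rs, hmem, hreg, hlen⟩ : ∃ rs : List R,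
      (∀ r ∈ rs, r ∈ (HomogeneousIdeal.irrelevant 𝒜).toIdeal) ∧
        RingTheory.Sequence.IsRegular R rs ∧ 2 ≤ rs.length := by
    by_contra! hcon
    have h1 : depth 𝒜 ≤ 1 := iSup_le fun rs => iSup_le fun h1 => iSup_le fun h2 => by
      exact_mod_cast Nat.lt_succ_iff.1 (hcon rs h1 h2)
    exact absurd (h.trans h1) (by decide)
  match rs, hlen with
  | a :: b :: rs, _ =>
    have hw := hreg.toIsWeaklyRegular
    rw [RingTheory.Sequence.isWeaklyRegular_cons_iff,
      RingTheory.Sequence.isWeaklyRegular_cons_iff] at hw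
    refine ⟨a, b, hmem a (by simp), hmem b (by simp), fun r hr => ?_, fun r hr => ?_⟩
    · exact hw.1 (by simpa using hr)
    · have hmk (s : R) : (Submodule.Quotient.mk s : QuotSMulTop a R) = 0 ↔ a ∣ s := by
        rw [Submodule.Quotient.mk_eq_zero, Submodule.mem_smul_pointwise_iff_exists]
        exact ⟨fun ⟨y, _, hy⟩ => ⟨y, hy.symm⟩, fun ⟨y, hy⟩ => ⟨y, trivial, hy.symm⟩⟩
      rw [← hmk] at hr ⊢
      refine hw.2.1 ?_
      change b • (Submodule.Quotient.mk r : QuotSMulTop a R) = b • 0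
      rw [smul_zero]
      exact hr

namespace IsStandardGraded

/-- If the Hilbert function of `R f` is bounded and `a` is regular, then `R f / a R f` is
finite-dimensional, so that every `b` is algebraic on it. -/
theorem polynomial_mul_eq_of_finrank_le (h𝒜 : IsStandardGraded 𝒜) {a : R}
    (hreg : ∀ r, a * r = 0 → r = 0) {f : R} {n : ℕ}
    (hn : ∀ j, Module.finrank K ((𝒜 j).map (LinearMap.mulRight K f)) ≤ n) (b : R) :
    ∃ p : K[X], p ≠ 0 ∧ ∃ r, aeval b p * f = a * (r * f) := by
  classical
  have := h𝒜.finiteDimensional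
  -- `F k` consists of the elements of `R` all of whose components have degree less than `k`.
  let F : ℕ → Submodule K R := fun k => (Finset.range k).sup 𝒜
  have hFmono : Monotone F := fun i j hij => Finset.sup_mono (Finset.range_subset_range.2 hij)
  have hFle (i k) (hik : i < k) : 𝒜 i ≤ F k := Finset.le_sup (f := 𝒜) (Finset.mem_range.2 hik)
  have hFmem (r : R) : ∃ k, r ∈ F k := by
    refine ⟨(DirectSum.decompose 𝒜 r).support.sup id + 1, ?_⟩
    rw [← DirectSum.sum_support_decompose 𝒜 r]
    refine Submodule.sum_mem _ fun i hi => hFle i _ ?_ (SetLike.coe_mem _)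
    rw [DirectSum.sum_support_decompose 𝒜 r]
    exact Nat.lt_succ_of_le (Finset.le_sup (f := id) hi)
  have hFmul (i k) : F i * F k ≤ F (i + k) := by
    simp only [F, Finset.sup_eq_iSup, Submodule.iSup_mul, Submodule.mul_iSup]
    refine iSup₂_le fun k' hk => iSup₂_le fun i' hi => Submodule.mul_le.2 fun x hx y hy => ?_
    rw [Finset.mem_range] at hi hk
    rw [← Finset.sup_eq_iSup]
    exact hFle (i' + k') _ (by omega) (SetLike.mul_mem_graded hx hy)
  let U : ℕ → Submodule K R := fun k => (F k).map (LinearMap.mulRight K f)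
  have hUfin (k) : FiniteDimensional K (U k) := by
    simp only [U, F]; infer_instance
  have hUadd (k e) : Module.finrank K (U (k + e)) ≤ Module.finrank K (U k) + e * n := by
    induction e with
    | zero => simp
    | succ e ih =>
      have h1 : U (k + (e + 1)) = (𝒜 (k + e)).map (LinearMap.mulRight K f) ⊔ U (k + e) := by
        simp only [U, F]
        rw [← add_assoc, Finset.range_add_one, Finset.sup_insert, Submodule.map_sup]
      rw [h1]
      have h2 := Submodule.finrank_add_le_finrank_add_finrank
        ((𝒜 (k + e)).map (LinearMap.mulRight K f)) (U (k + e))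
      have h3 := hn (k + e)
      have h4 : (e + 1) * n = e * n + n := by ring
      omega
  obtain ⟨e, he⟩ := hFmem a
  choose N hN using hFmem
  let k := (Finset.range (e * n + 1)).sup fun i => N (b ^ i)
  -- `a` is a sum of components of degree less than `e`, so that `aU` has codimension at most `e * n`
  -- in `U (k + e)`; here `k` is so large that `U k` contains `b ^ i * f` for all `i ≤ e * n`.
  let aU : Submodule K R := (U k).map (LinearMap.mulLeft K a)
  have haU : aU ≤ U (k + e) := by
    rintro _ ⟨_, ⟨r, hr, rfl⟩, rfl⟩
    refine ⟨a * r, add_comm e k ▸ hFmul e k (Submodule.mul_mem_mul he hr), ?_⟩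
    simp [mul_assoc]
  have hdim := Submodule.finrank_map_add_finrank_inf_ker aU.mkQ (U (k + e))
  have haUdim : Module.finrank K aU = Module.finrank K (U k) := by
    refine (LinearEquiv.finrank_eq (Submodule.equivMapOfInjective (LinearMap.mulLeft K a) ?_
      (U k))).symm
    rw [← LinearMap.ker_eq_bot, LinearMap.ker_eq_bot']
    exact hreg
  rw [Submodule.ker_mkQ, inf_eq_right.2 haU, haUdim] at hdim
  have hle : Module.finrank K ((U (k + e)).map aU.mkQ) ≤ e * n := by
    have := hUadd k e
    omega
  have hdep : ¬ LinearIndependent K fun i : Fin (e * n + 1) =>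
      (⟨aU.mkQ (b ^ (i : ℕ) * f), ⟨_, ⟨b ^ (i : ℕ), hFmono (le_trans (Finset.le_sup
        (f := fun i => N (b ^ i)) (Finset.mem_range.2 i.2)) (Nat.le_add_right k e))
          (hN (b ^ (i : ℕ))), rfl⟩, rfl⟩⟩ : (U (k + e)).map aU.mkQ) := fun h => by
    have := h.fintype_card_le_finrank
    rw [Fintype.card_fin] at this
    omega
  rw [Fintype.not_linearIndependent_iff] at hdep
  obtain ⟨c, hc, i, hi⟩ := hdep
  refine ⟨∑ i : Fin (e * n + 1), monomial (i : ℕ) (c i), fun h0 => hi ?_, ?_⟩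
  · have := congr_arg (fun q : K[X] => q.coeff (i : ℕ)) h0
    simpa [finsetSum_coeff, coeff_monomial, Fin.val_inj] using this
  · have h1 := congr_arg Subtype.val hc
    simp only [Submodule.coe_sum, Submodule.coe_smul, ← map_smul, ← map_sum] at h1
    obtain ⟨_, ⟨r, -, rfl⟩, hr⟩ := (Submodule.Quotient.mk_eq_zero _).1 h1
    refine ⟨r, ?_⟩
    rw [LinearMap.mulRight_apply, LinearMap.mulLeft_apply] at hr
    rw [hr, map_sum, Finset.sum_mul]
    refine Finset.sum_congr rfl fun i _ => ?_
    rw [aeval_monomial, ← Algebra.smul_def, smul_mul_assoc]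

/-- Elements `f` whose ideal has dimension at most one vanish in the presence of a regular sequence
`a, b`. Write `p = X ^ m * q` with `q(0) ≠ 0`, and let `J` be the double annihilator of `f`. Then
`b ^ m * q(b)` multiplies `J` into `a J`, and regularity of `b` modulo `a` lets one cancel
`b ^ m`. As `q(b)` is a nonzero constant modulo the irrelevant ideal `𝔪`, this gives `J = 𝔪 J`, and
Nakayama's lemma yields `f = 0`. -/
theorem eq_zero_of_polynomial_mul_eq (h𝒜 : IsStandardGraded 𝒜) {a b : R}
    (ha : a ∈ (HomogeneousIdeal.irrelevant 𝒜).toIdeal)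
    (hb : b ∈ (HomogeneousIdeal.irrelevant 𝒜).toIdeal)
    (hreg : ∀ r, a * r = 0 → r = 0) (hab : ∀ r, a ∣ b * r → a ∣ r) {f : R} {t : ℕ}
    (hf : f ∈ 𝒜 t) {p : K[X]} (hp : p ≠ 0) {r : R} (hr : aeval b p * f = a * (r * f)) : f = 0 := by
  have := h𝒜.isNoetherianRing
  obtain ⟨q, hpq, hq⟩ := exists_eq_pow_rootMultiplicity_mul_and_not_dvd p hp 0
  rw [C_0, sub_zero] at hpq hq
  rw [X_dvd_iff] at hq
  set m := p.rootMultiplicity 0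
  have hpow (k : ℕ) (s : R) (hs : a ∣ b ^ k * s) : a ∣ s := by
    induction k with
    | zero => simpa using hs
    | succ k ih => exact ih (hab _ (by rwa [← mul_assoc, ← pow_succ']))
  -- The double annihilator of `f`.
  let J : Ideal R := (R ∙ f).annihilator.annihilator
  have hJ (g : R) : g ∈ J ↔ ∀ s, s * f = 0 → s * g = 0 := by
    rw [Submodule.mem_annihilator]
    refine forall_congr' fun s => ?_
    rw [Submodule.mem_annihilator_span_singleton, smul_eq_mul, smul_eq_mul, mul_comm g]
  have hJle : J ≤ (HomogeneousIdeal.irrelevant 𝒜).toIdeal • J := by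
    intro g hg
    have h1 : aeval b p * g = a * (r * g) := by
      have := (hJ g).1 hg (aeval b p - a * r) (by rw [sub_mul, hr]; ring)
      rw [sub_mul, sub_eq_zero] at this
      rw [this, mul_assoc]
    rw [hpq, map_mul, map_pow, aeval_X, mul_assoc] at h1
    obtain ⟨g', hg'⟩ := hpow m _ ⟨_, h1⟩
    have hg'J : g' ∈ J := (hJ g').2 fun s hs => hreg _ (by
      rw [mul_left_comm, ← hg', mul_left_comm, (hJ g).1 hg s hs, mul_zero])
    have h2 : q.coeff 0 • g = a * g' - b * (aeval b q.divX * g) := by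
      have hq' := congr_arg (aeval b) (X_mul_divX_add q)
      rw [map_add, map_mul, aeval_X, aeval_C] at hq'
      rw [← hg', ← hq', Algebra.smul_def]
      ring
    have h3 : g = (q.coeff 0)⁻¹ • (a * g' - b * (aeval b q.divX * g)) := by
      rw [← h2, smul_smul, inv_mul_cancel₀ hq, one_smul]
    rw [h3]
    exact Submodule.smul_of_tower_mem _ _ (sub_mem (Submodule.smul_mem_smul ha hg'J)
      (Submodule.smul_mem_smul hb (J.mul_mem_left _ hg)))
  obtain ⟨s, hs, hsJ⟩ := Submodule.exists_sub_one_mem_and_smul_eq_zero_of_fg_of_le_smul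
    (HomogeneousIdeal.irrelevant 𝒜).toIdeal J (IsNoetherian.noetherian J) hJle
  have hsf : s * f = 0 := hsJ f ((hJ f).2 fun _ => id)
  -- Compare the components of degree `t` in `(s - 1) * f = -f`.
  have h4 : (DirectSum.decompose 𝒜 ((s - 1) * f) (0 + t) : R) =
      DirectSum.decompose 𝒜 (s - 1) 0 * f :=
    DirectSum.coe_decompose_mul_add_of_right_mem 𝒜 hf
  have h5 : (DirectSum.decompose 𝒜 (s - 1) 0 : R) = 0 := hs
  rw [h5, zero_mul, zero_add, sub_mul, hsf, one_mul, zero_sub, DirectSum.decompose_neg,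
    DFinsupp.neg_apply, NegMemClass.coe_neg, DirectSum.decompose_of_mem_same 𝒜 hf] at h4
  exact neg_eq_zero.1 h4

/-- In depth at least two, every ideal that is nonzero in degree `t` is strictly larger in degree
`t + 1`. -/
theorem finrank_inf_lt_finrank_inf_succ (h𝒜 : IsStandardGraded 𝒜) (hdepth : 2 ≤ depth 𝒜)
    {I : Ideal R} {t : ℕ} {f : R} (hf : f ∈ 𝒜 t) (hfI : f ∈ I) (hf0 : f ≠ 0) :
    Module.finrank K (𝒜 t ⊓ I.restrictScalars K : Submodule K R) <
      Module.finrank K (𝒜 (t + 1) ⊓ I.restrictScalars K : Submodule K R) := by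
  by_contra! hle
  obtain ⟨a, b, ha, hb, hreg, hab⟩ := exists_regular_pair hdepth
  obtain ⟨p, hp, r, hr⟩ := h𝒜.polynomial_mul_eq_of_finrank_le hreg
    (h𝒜.finrank_map_mulRight_le ha hreg hle hf hfI) b
  exact hf0 (h𝒜.eq_zero_of_polynomial_mul_eq ha hb hreg hab hf hp hr)

end IsStandardGraded
end GMD

/-! ### Monotonicity of the generalized minimum distance function -/

namespace GMD

variable {K R : Type*} [Field K] [CommRing R] [Algebra K R] {𝒜 : ℕ → Submodule K R}
  [GradedAlgebra 𝒜] {t ℓ : ℕ}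

theorem isHomogeneous_span_range {F : Fin ℓ → R} (hF : ∀ i, F i ∈ 𝒜 t) :
    (Ideal.span (Set.range F)).IsHomogeneous 𝒜 :=
  Ideal.homogeneous_span 𝒜 _ (by rintro _ ⟨i, rfl⟩; exact ⟨t, hF i⟩)

namespace IsStandardGraded

/-- The ideal of a member of `ℱ_{t,ℓ}` contains the ideal of a member of `ℱ_{t+1,ℓ+1}`, since it
has more than `ℓ` linearly independent elements in degree `t + 1`. -/
theorem exists_mem_family_succ (h𝒜 : IsStandardGraded 𝒜) (hdepth : 2 ≤ depth 𝒜) (hℓ : 1 ≤ ℓ)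
    {F : Fin ℓ → R} (hF : F ∈ family 𝒜 t ℓ) :
    ∃ G ∈ family 𝒜 (t + 1) (ℓ + 1), Ideal.span (Set.range G) ≤ Ideal.span (Set.range F) := by
  obtain ⟨hFt, hFind, hFann⟩ := hF
  have := h𝒜.finiteDimensional
  set I := Ideal.span (Set.range F) with hI
  have hFI (i) : F i ∈ I := Ideal.subset_span ⟨i, rfl⟩
  have hlt := h𝒜.finrank_inf_lt_finrank_inf_succ hdepth (hFt ⟨0, hℓ⟩) (hFI ⟨0, hℓ⟩)
    (hFind.ne_zero _)
  have hle : ℓ ≤ Module.finrank K (𝒜 t ⊓ I.restrictScalars K : Submodule K R) := by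
    have h1 : LinearIndependent K fun i =>
        (⟨F i, hFt i, hFI i⟩ : (𝒜 t ⊓ I.restrictScalars K : Submodule K R)) :=
      LinearIndependent.of_comp (Submodule.subtype _) hFind
    simpa using h1.fintype_card_le_finrank
  obtain ⟨g, hg⟩ := exists_linearIndependent_of_le_finrank (hle.trans_lt hlt)
  have hGF : Ideal.span (Set.range fun i => (g i : R)) ≤ I :=
    Ideal.span_le.2 (by rintro _ ⟨i, rfl⟩; exact (g i).2.2)
  exact ⟨fun i => g i, ⟨fun i => (g i).2.1, hg.map' (Submodule.subtype _) (Submodule.ker_subtype _),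
    ne_bot_of_le_ne_bot hFann (Submodule.annihilator_mono hGF)⟩, hGF⟩

theorem mult_quotient_span_le (h𝒜 : IsStandardGraded 𝒜) {F : Fin ℓ → R} (hF : F ∈ family 𝒜 t ℓ) :
    mult R (quotientPieces 𝒜 (Ideal.span (Set.range F))) ≤ mult R 𝒜 :=
  h𝒜.mult_quotientPieces_bot ▸ h𝒜.mult_quotientPieces_anti (Ideal.IsHomogeneous.bot 𝒜)
    (isHomogeneous_span_range hF.1) bot_le

theorem finite_mult_image_family (h𝒜 : IsStandardGraded 𝒜) (t ℓ : ℕ) :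
    ((fun F => mult R (quotientPieces 𝒜 (Ideal.span (Set.range F)))) '' family 𝒜 t ℓ).Finite := by
  obtain ⟨N, hN⟩ := h𝒜.exists_mult_quotientPieces_eq (Ideal.IsHomogeneous.bot 𝒜)
  rw [h𝒜.mult_quotientPieces_bot] at hN
  refine ((Set.finite_Iic N).image ((↑) : ℕ → ℝ)).subset ?_
  rintro _ ⟨F, hF, rfl⟩
  obtain ⟨n, hn⟩ := h𝒜.exists_mult_quotientPieces_eq (isHomogeneous_span_range hF.1)
  refine ⟨n, ?_, hn.symm⟩
  have := h𝒜.mult_quotient_span_le hF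
  rw [hn, hN] at this
  exact_mod_cast this

theorem delta_le_of_mem_family (h𝒜 : IsStandardGraded 𝒜) {F : Fin ℓ → R}
    (hF : F ∈ family 𝒜 t ℓ) :
    delta 𝒜 t ℓ ≤ mult R 𝒜 - mult R (quotientPieces 𝒜 (Ideal.span (Set.range F))) := by
  rw [delta, if_pos ⟨F, hF⟩]
  gcongr
  exact le_csSup (h𝒜.finite_mult_image_family t ℓ).bddAbove ⟨F, hF, rfl⟩

theorem exists_delta_eq (h𝒜 : IsStandardGraded 𝒜) (h : (family 𝒜 t ℓ).Nonempty) :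
    ∃ F ∈ family 𝒜 t ℓ,
      delta 𝒜 t ℓ = mult R 𝒜 - mult R (quotientPieces 𝒜 (Ideal.span (Set.range F))) := by
  obtain ⟨F, hF, hFs⟩ := (h.image _).csSup_mem (h𝒜.finite_mult_image_family t ℓ)
  refine ⟨F, hF, ?_⟩
  rw [delta, if_pos h, ← hFs]

theorem delta_le_mult (h𝒜 : IsStandardGraded 𝒜) (t ℓ : ℕ) : delta 𝒜 t ℓ ≤ mult R 𝒜 := by
  by_cases h : (family 𝒜 t ℓ).Nonempty
  · obtain ⟨F, hF, hd⟩ := h𝒜.exists_delta_eq h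
    obtain ⟨n, hn⟩ := h𝒜.exists_mult_quotientPieces_eq (isHomogeneous_span_range hF.1)
    rw [hd, hn]
    exact sub_le_self _ n.cast_nonneg
  · rw [delta, if_neg h]

theorem exists_delta_eq_natCast (h𝒜 : IsStandardGraded 𝒜) (t ℓ : ℕ) :
    ∃ n : ℕ, delta 𝒜 t ℓ = n := by
  obtain ⟨N, hN⟩ := h𝒜.exists_mult_quotientPieces_eq (Ideal.IsHomogeneous.bot 𝒜)
  rw [h𝒜.mult_quotientPieces_bot] at hN
  by_cases h : (family 𝒜 t ℓ).Nonempty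
  · obtain ⟨F, hF, hd⟩ := h𝒜.exists_delta_eq h
    obtain ⟨n, hn⟩ := h𝒜.exists_mult_quotientPieces_eq (isHomogeneous_span_range hF.1)
    have hle := h𝒜.mult_quotient_span_le hF
    rw [hn, hN, Nat.cast_le] at hle
    exact ⟨N - n, by rw [hd, hn, hN, Nat.cast_sub hle]⟩
  · exact ⟨N, by rw [delta, if_neg h, hN]⟩

theorem delta_le_delta (h𝒜 : IsStandardGraded 𝒜) {t' ℓ' : ℕ}
    (h : ∀ F ∈ family 𝒜 t ℓ, ∃ G ∈ family 𝒜 t' ℓ',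
      Ideal.span (Set.range G) ≤ Ideal.span (Set.range F)) :
    delta 𝒜 t' ℓ' ≤ delta 𝒜 t ℓ := by
  by_cases hne : (family 𝒜 t ℓ).Nonempty
  · obtain ⟨F, hF, hd⟩ := h𝒜.exists_delta_eq hne
    obtain ⟨G, hG, hGF⟩ := h F hF
    rw [hd]
    refine (h𝒜.delta_le_of_mem_family hG).trans ?_
    gcongr
    exact h𝒜.mult_quotientPieces_anti (isHomogeneous_span_range hG.1)
      (isHomogeneous_span_range hF.1) hGF
  · rw [delta.eq_def 𝒜 t ℓ, if_neg hne]
    exact h𝒜.delta_le_mult t' ℓ'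

theorem delta_succ_succ_le (h𝒜 : IsStandardGraded 𝒜) (hdepth : 2 ≤ depth 𝒜) (hℓ : 1 ≤ ℓ) (t : ℕ) :
    delta 𝒜 (t + 1) (ℓ + 1) ≤ delta 𝒜 t ℓ :=
  h𝒜.delta_le_delta fun _ => h𝒜.exists_mem_family_succ hdepth hℓ

theorem delta_le_delta_succ (h𝒜 : IsStandardGraded 𝒜) (t ℓ : ℕ) :
    delta 𝒜 t ℓ ≤ delta 𝒜 t (ℓ + 1) := by
  refine h𝒜.delta_le_delta fun F hF => ?_
  have hle : Ideal.span (Set.range (F ∘ Fin.castSucc)) ≤ Ideal.span (Set.range F) :=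
    Ideal.span_mono (Set.range_comp_subset_range _ _)
  exact ⟨F ∘ Fin.castSucc, ⟨fun i => hF.1 _, hF.2.1.comp _ (Fin.castSucc_injective ℓ),
    ne_bot_of_le_ne_bot hF.2.2 (Submodule.annihilator_mono hle)⟩, hle⟩

theorem delta_antitone (h𝒜 : IsStandardGraded 𝒜) (hdepth : 2 ≤ depth 𝒜) (hℓ : 1 ≤ ℓ) :
    Antitone fun t => delta 𝒜 t ℓ :=
  antitone_nat_of_succ_le fun t =>
    (h𝒜.delta_le_delta_succ (t + 1) ℓ).trans (h𝒜.delta_succ_succ_le hdepth hℓ t)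

/-- A nonincreasing sequence of natural numbers is eventually constant. -/
theorem eventually_delta_eq (h𝒜 : IsStandardGraded 𝒜) (hdepth : 2 ≤ depth 𝒜) (hℓ : 1 ≤ ℓ) :
    ∀ᶠ t in atTop, delta 𝒜 t ℓ = stabilizationValue 𝒜 ℓ := by
  choose d hd using fun t => h𝒜.exists_delta_eq_natCast t ℓ
  have hanti : Antitone d := fun i j hij => by
    have := h𝒜.delta_antitone hdepth hℓ hij
    simp only [hd, Nat.cast_le] at this
    exact this
  obtain ⟨t₀, ht₀⟩ := Nat.sInf_mem (Set.range_nonempty d)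
  have hconst : ∀ᶠ t in atTop, delta 𝒜 t ℓ = d t₀ := by
    filter_upwards [eventually_ge_atTop t₀] with t ht
    rw [hd, Nat.cast_inj]
    exact (hanti ht).antisymm (ht₀ ▸ Nat.sInf_le ⟨t, rfl⟩)
  have hlim : stabilizationValue 𝒜 ℓ = d t₀ :=
    (tendsto_const_nhds.congr' (hconst.mono fun _ h => h.symm)).limUnder_eq
  rwa [hlim]

theorem stabilizationValue_le_delta (h𝒜 : IsStandardGraded 𝒜) (hdepth : 2 ≤ depth 𝒜)
    (hℓ : 1 ≤ ℓ) (t : ℕ) : stabilizationValue 𝒜 ℓ ≤ delta 𝒜 t ℓ := by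
  obtain ⟨t', ht', ht⟩ := ((h𝒜.eventually_delta_eq hdepth hℓ).and (eventually_ge_atTop t)).exists
  exact ht' ▸ h𝒜.delta_antitone hdepth hℓ ht

theorem stabilizationValue_le_succ (h𝒜 : IsStandardGraded 𝒜) (hdepth : 2 ≤ depth 𝒜)
    (hℓ : 1 ≤ ℓ) : stabilizationValue 𝒜 ℓ ≤ stabilizationValue 𝒜 (ℓ + 1) := by
  obtain ⟨t, ht⟩ := (h𝒜.eventually_delta_eq hdepth (Nat.le_succ_of_le hℓ)).exists
  exact ht ▸ (h𝒜.stabilizationValue_le_delta hdepth hℓ t).trans (h𝒜.delta_le_delta_succ t ℓ)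

end IsStandardGraded
end GMD

theorem mainTheorem3 {K R : Type*} [Field K] [CommRing R] [Algebra K R]
    (𝒜 : ℕ → Submodule K R) [GradedAlgebra 𝒜] (h𝒜 : GMD.IsStandardGraded 𝒜)
    [IsReduced R] (hdepth : 2 ≤ GMD.depth 𝒜) (ℓ : ℕ) (hℓ : 1 ≤ ℓ) :
    (∀ᶠ t in atTop, GMD.delta 𝒜 t ℓ = GMD.stabilizationValue 𝒜 ℓ) ∧
    GMD.regularityIndex 𝒜 (ℓ + 1) ≤ GMD.regularityIndex 𝒜 ℓ + 1 := by
  have hℓ' : 1 ≤ ℓ + 1 := Nat.le_add_left 1 ℓ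
  have hev := h𝒜.eventually_delta_eq hdepth hℓ
  refine ⟨hev, Nat.sInf_le ⟨Nat.le_add_left 1 _, le_antisymm ?_
    (h𝒜.stabilizationValue_le_delta hdepth hℓ' _)⟩⟩
  have hr : GMD.delta 𝒜 (GMD.regularityIndex 𝒜 ℓ) ℓ = GMD.stabilizationValue 𝒜 ℓ :=
    (Nat.sInf_mem ((eventually_ge_atTop 1).and hev).exists).2
  calc GMD.delta 𝒜 (GMD.regularityIndex 𝒜 ℓ + 1) (ℓ + 1)
      ≤ GMD.delta 𝒜 (GMD.regularityIndex 𝒜 ℓ) ℓ := h𝒜.delta_succ_succ_le hdepth hℓ _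
    _ = GMD.stabilizationValue 𝒜 ℓ := hr
    _ ≤ GMD.stabilizationValue 𝒜 (ℓ + 1) := h𝒜.stabilizationValue_le_succ hdepth hℓ
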